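/- Let $1<\alpha\le 2$, $\beta=\frac{\alpha}{\alpha-1}$, $\varphi(x)=\frac{|x|^\alpha}{\alpha}$. A random variable $\zeta$ is $\varphi$-sub-Gaussian if $\mathbb E\zeta=0$, $\mathbb E e^{\lambda\zeta}<\infty$ for all $\lambda\in\mathbb R$, and for some $a>0$ one has $\mathbb E e^{\lambda\zeta}\le e^{\varphi(\lambda a)}$ for all $\lambda\in\mathbb R$; $\tau_\varphi(\zeta)$ denotes the infimum of all such $a>0$. Let $A\ge 0$, $V=[0,\infty)\times[-A,A]$, $H_1,H_2\in(0,1]$ and $d(t,s)=|t_1-s_1|^{H_1}+|t_2-s_2|^{H_2}$. Let $f:[0,\infty)\to(0,\infty)$ be continuous and strictly increasing with $f(t)\to\infty$ as $t\to\infty$, and let $0=b_0<b_1<b_2<\cdots$ with $b_k\to\infty$. Put $l_k=b_{k+1}-b_k$, $V_k=[b_k,b_{k+1}]\times[-A,A]$, $f_k=f(b_k)$. Let $X(t_1,t_2)$, $(t_1,t_2)\in V$, be a separable field of $\varphi$-sub-Gaussian random variables, that is, there are a countable dense subset $S$ of $V$ and a null event outside of which, for all closed $F\subseteq\mathbb R$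 and all open $G$, if $X(s)\in F$ for all $s\in G\cap S$, then $X(t)\in F$ for all $t\in G\cap V$. Suppose that: (i) there are $\gamma\in(0,1]$ with $\gamma\beta>1$ and $c_k>0$ such that for all $k\ge 0$ and $h>0$ $$\sup_{t,s\in V_k,\ d(t,s)\le h}\tau_\varphi(X(t)-X(s))\le c_k h^\gamma;$$ (ii) there are $\delta>0$ and $c(\delta)>0$ such that $\tau_\varphi(X(t_1,t_2))\le c(\delta)\,t_1^\delta$ for all $(t_1,t_2)\in V$; (iii) $\widetilde C=c(\delta)\sum_{k=0}^\infty \frac{b_{k+1}^{\delta}}{f_k}<\infty$; (iv) $\widetilde S=(c(\delta))^{1-\frac1{\gamma\beta}}\sum_{k=0}^\infty \frac{b_{k+1}^{\delta\left(1-\frac1{\gamma\beta}\right)}c_1(k)}{f_k}<\infty$, where $$c_1(k)=\Big(\tfrac1{H_1}\big(\tfrac{l_k}{2}\big)^{\frac{H_1}{\beta}}+\tfrac1{H_2}A^{\frac{H_2}{\beta}}\Big)\frac{2^{\frac1\beta}c_k^{\frac1{\gamma\beta}}}{1-\frac1{\gamma\beta}}.$$ Then there is a random variable $\xi$ such that,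 with probability one, $|X(t_1,t_2)|\le f(t_1)\,\xi$ for all $(t_1,t_2)\in V$, and for every $u>(1+2\widetilde S)^{\frac{\gamma\beta+1}{\gamma\beta}}$ $$\mathbb P\{\xi>u\}\le 2\exp\Big\{-\frac1{\beta\widetilde C^\beta}\Big(u-u^{\frac1{\gamma\beta+1}}(1+2\widetilde S)\Big)^\beta\Big\}.$$ -/

import Mathlib

open MeasureTheory Set Filter Topology

noncomputable section

/-- `ζ` belongs to `Sub_φ(Ω)`: it is a centred random variable with all exponential moments and
`E exp (lam ζ) ≤ exp (φ (lam a))` for all real `lam`, for some `a > 0`. -/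
structure IsPhiSubGaussian {Ω : Type*} [MeasurableSpace Ω] (μ : Measure Ω) (φ : ℝ → ℝ)
    (ζ : Ω → ℝ) : Prop where
  measurable : Measurable ζ
  integrable_exp : ∀ lam : ℝ, Integrable (fun ω => Real.exp (lam * ζ ω)) μ
  mean_zero : ∫ ω, ζ ω ∂μ = 0
  bound : ∃ a : ℝ, 0 < a ∧ ∀ lam : ℝ, ∫ ω, Real.exp (lam * ζ ω) ∂μ ≤ Real.exp (φ (lam * a))

/-- The norm `τ_φ` of the space `Sub_φ(Ω)`. -/
def tauPhi {Ω : Type*} [MeasurableSpace Ω] (μ : Measure Ω) (φ : ℝ → ℝ) (ζ : Ω → ℝ) : ℝ :=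
  sInf {a : ℝ | 0 < a ∧
    ∀ lam : ℝ, ∫ ω, Real.exp (lam * ζ ω) ∂μ ≤ Real.exp (φ (a * lam))}

/-- The function `φ(x) = |x| ^ α / α`. -/
def powerPhi (α : ℝ) (x : ℝ) : ℝ := |x| ^ α / α

/-- The anisotropic metric `d(t, s) = |t₁ - s₁| ^ H₁ + |t₂ - s₂| ^ H₂` on the plane. -/
def anisoDist (H₁ H₂ : ℝ) (t s : ℝ × ℝ) : ℝ := |t.1 - s.1| ^ H₁ + |t.2 - s.2| ^ H₂

/-- The half-strip `V = [0, ∞) × [-A, A]`. -/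
def halfStrip (A : ℝ) : Set (ℝ × ℝ) := Ici 0 ×ˢ Icc (-A) A

/-- The rectangle `V_k = [b_k, b_{k+1}] × [-A, A]`. -/
def stripBlock (A : ℝ) (b : ℕ → ℝ) (k : ℕ) : Set (ℝ × ℝ) :=
  Icc (b k) (b (k + 1)) ×ˢ Icc (-A) A

/-- The field `X` is separable on `T` (in the sense of Doob): there are a countable dense subset `S`
of `T` and one null event outside which, for every closed `F ⊆ ℝ` and every open `G`, if the values
of `X` on `G ∩ S` lie in `F` then so do all the values of `X` on `G ∩ T`. The topology is the usual
one of the plane, which is also the topology of every metric `anisoDist H₁ H₂`, `0 < H₁, H₂ ≤ 1`. -/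
def IsSeparableField {Ω : Type*} [MeasurableSpace Ω] (μ : Measure Ω) (T : Set (ℝ × ℝ))
    (X : ℝ × ℝ → Ω → ℝ) : Prop :=
  ∃ S : Set (ℝ × ℝ), S.Countable ∧ S ⊆ T ∧ T ⊆ closure S ∧
    ∀ᵐ ω ∂μ, ∀ F : Set ℝ, IsClosed F → ∀ G : Set (ℝ × ℝ), IsOpen G →
      (∀ s ∈ G ∩ S, X s ω ∈ F) → ∀ t ∈ G ∩ T, X t ω ∈ F

/-- The number `c₁(k)`; here `l_k = b_{k+1} - b_k`. -/
def blockConst (H₁ H₂ A γ β : ℝ) (b c : ℕ → ℝ) (k : ℕ) : ℝ :=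
  (1 / H₁ * ((b (k + 1) - b k) / 2) ^ (H₁ / β) + 1 / H₂ * A ^ (H₂ / β)) *
    (2 ^ (1 / β) * c k ^ (1 / (γ * β)) / (1 - 1 / (γ * β)))

/-- The terms of the series that defines `C̃`. -/
def growthCTerm (δ : ℝ) (b : ℕ → ℝ) (f : ℝ → ℝ) (k : ℕ) : ℝ :=
  b (k + 1) ^ δ / f (b k)

/-- The constant `C̃`. -/
def growthC (cδ δ : ℝ) (b : ℕ → ℝ) (f : ℝ → ℝ) : ℝ :=
  cδ * ∑' k, growthCTerm δ b f k

/-- The terms of the series that defines `S̃`. -/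
def growthSTerm (δ H₁ H₂ A γ β : ℝ) (b c : ℕ → ℝ) (f : ℝ → ℝ) (k : ℕ) : ℝ :=
  b (k + 1) ^ (δ * (1 - 1 / (γ * β))) * blockConst H₁ H₂ A γ β b c k / f (b k)

/-- The constant `S̃`. -/
def growthS (cδ δ H₁ H₂ A γ β : ℝ) (b c : ℕ → ℝ) (f : ℝ → ℝ) : ℝ :=
  cδ ^ (1 - 1 / (γ * β)) * ∑' k, growthSTerm δ H₁ H₂ A γ β b c f k

end

/-! The proof is chaining over all blocks at once, with geometric ratio `p`. On `V_k` put ε_k = c(δ)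
b_{k+1}^δ, which bounds τ_φ(X(t)) there, and take nets fine enough that the n-th chaining link has
scale ε_k pⁿ. Then |X| on `V_k` is at most a sum over n of maxima of `N` variables of that scale.
Dividing by f_k and summing over k as well gives a random majorant of |X|/f, a sum of variables with
scales a_i and cardinalities N_i indexed by (k, n).

`measure_finset_sum_gt_le` controls such a sum: with D ≥ ∑ a_i and M ≥ ∑ a_i (log N_i)^{1/β},
Jensen's inequality with suitable weights and Markov's inequality give the tail 2 exp(-((u -
2M)/D)^β / β). The prefactor stays 2, however many terms there are, because the weights sum to at
most one. No independence is used.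

The entropy bound `log_net_card_rpow_le` and geometric series allow D = C̃/(1-p) and M = S̃
p^{-1/(γβ)}/(1-p). The choice p = u^{-γβ/(γβ+1)} then produces the stated exponent. Since the
chaining majorant depends on `p`, hence on `u`, ξ is instead the supremum of |X|/f over the
separability set: it does not depend on `p`, and every chaining majorant dominates it almost surely
(`exists_majorant_of_separable`). -/

/-- `Z` is measurable and its moment generating function is bounded by `exp (φ (s a))`,
where `φ(x) = |x| ^ α / α`. -/
structure IsPhiDominated {Ω : Type*} [MeasurableSpace Ω] (μ : Measure Ω) (α a : ℝ)
    (Z : Ω → ℝ) : Prop where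
  measurable : Measurable Z
  lintegral_le : ∀ s : ℝ, ∫⁻ ω, ENNReal.ofReal (Real.exp (s * Z ω)) ∂μ ≤
    ENNReal.ofReal (Real.exp (powerPhi α (s * a)))

/-! ### Moment generating functions of φ-sub-Gaussian variables and of their maxima. -/

section

variable {Ω : Type*} [MeasurableSpace Ω] {μ : Measure Ω}

theorem powerPhi_mono {α x y : ℝ} (hα : 0 < α) (h : |x| ≤ |y|) :
    powerPhi α x ≤ powerPhi α y := by
  unfold powerPhi
  gcongr

theorem continuous_powerPhi {α : ℝ} (hα : 0 < α) : Continuous (powerPhi α) := by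
  unfold powerPhi
  exact (continuous_abs.rpow_const fun _ => Or.inr hα.le).div_const _

/-- A real infimum over the empty set is 0, so a bound on `tauPhi` of an increment is informative
only once some admissible `a` exists. It comes from 2xy ≤ x² + y², which separates the two variables
without independence. -/
theorem IsPhiSubGaussian.exists_bound_sub {α : ℝ} (hα : 0 < α) {Y Z : Ω → ℝ}
    (hY : IsPhiSubGaussian μ (powerPhi α) Y) (hZ : IsPhiSubGaussian μ (powerPhi α) Z) :
    (∀ s : ℝ, Integrable (fun ω => Real.exp (s * (Y ω - Z ω))) μ) ∧
      ∃ a : ℝ, 0 < a ∧ ∀ s : ℝ,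
        ∫ ω, Real.exp (s * (Y ω - Z ω)) ∂μ ≤ Real.exp (powerPhi α (a * s)) := by
  obtain ⟨a, ha, hYa⟩ := hY.bound
  obtain ⟨c, hc, hZc⟩ := hZ.bound
  have key : ∀ s ω, Real.exp (s * (Y ω - Z ω)) ≤
      (Real.exp ((2 * s) * Y ω) + Real.exp ((-2 * s) * Z ω)) / 2 := by
    intro s ω
    have h1 : Real.exp (s * (Y ω - Z ω)) = Real.exp (s * Y ω) * Real.exp (-s * Z ω) := by
      rw [← Real.exp_add]; congr 1; ring
    have h2 : Real.exp ((2 * s) * Y ω) = Real.exp (s * Y ω) ^ 2 := by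
      rw [← Real.exp_nat_mul]; congr 1; push_cast; ring
    have h3 : Real.exp ((-2 * s) * Z ω) = Real.exp (-s * Z ω) ^ 2 := by
      rw [← Real.exp_nat_mul]; congr 1; push_cast; ring
    rw [h1, h2, h3]
    linarith [two_mul_le_add_sq (Real.exp (s * Y ω)) (Real.exp (-s * Z ω))]
  have hdom : ∀ s : ℝ, Integrable (fun ω =>
      (Real.exp ((2 * s) * Y ω) + Real.exp ((-2 * s) * Z ω)) / 2) μ := fun s =>
    ((hY.integrable_exp _).add (hZ.integrable_exp _)).div_const 2
  have hint : ∀ s : ℝ, Integrable (fun ω => Real.exp (s * (Y ω - Z ω))) μ := by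
    intro s
    refine (hdom s).mono' ?_ (Eventually.of_forall fun ω => ?_)
    · exact (Real.measurable_exp.comp
        ((hY.measurable.sub hZ.measurable).const_mul s)).aestronglyMeasurable
    · rw [Real.norm_of_nonneg (Real.exp_nonneg _)]
      exact key s ω
  refine ⟨hint, 2 * max a c, by positivity, fun s => ?_⟩
  calc ∫ ω, Real.exp (s * (Y ω - Z ω)) ∂μ
      ≤ ∫ ω, (Real.exp ((2 * s) * Y ω) + Real.exp ((-2 * s) * Z ω)) / 2 ∂μ :=
        integral_mono (hint s) (hdom s) (key s)
    _ = (∫ ω, Real.exp ((2 * s) * Y ω) ∂μ + ∫ ω, Real.exp ((-2 * s) * Z ω) ∂μ) / 2 := by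
        rw [integral_div, integral_add (hY.integrable_exp _) (hZ.integrable_exp _)]
    _ ≤ (Real.exp (powerPhi α (2 * max a c * s)) +
          Real.exp (powerPhi α (2 * max a c * s))) / 2 := by
        gcongr
        · refine (hYa _).trans (Real.exp_le_exp.2 (powerPhi_mono hα ?_))
          have : |2 * max a c * s| = 2 * |s| * max a c := by
            rw [abs_mul, abs_of_pos (by positivity : 0 < 2 * max a c)]; ring
          rw [this, abs_mul, abs_mul, abs_two, abs_of_pos ha]
          gcongr
          exact le_max_left _ _
        · refine (hZc _).trans (Real.exp_le_exp.2 (powerPhi_mono hα ?_))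
          have : |2 * max a c * s| = 2 * |s| * max a c := by
            rw [abs_mul, abs_of_pos (by positivity : 0 < 2 * max a c)]; ring
          rw [this, abs_mul, abs_mul, abs_neg, abs_two, abs_of_pos hc]
          gcongr
          exact le_max_right _ _
    _ = _ := by ring

/-- The infimum in the definition of `tauPhi` is attained, so an upper bound of `tauPhi` controls
the moment generating function. -/
theorem isPhiDominated_of_tauPhi_le {α : ℝ} (hα : 0 < α) {Z : Ω → ℝ} (hZ : Measurable Z)
    (hint : ∀ s : ℝ, Integrable (fun ω => Real.exp (s * Z ω)) μ)
    (hne : ∃ a : ℝ, 0 < a ∧ ∀ s : ℝ,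
      ∫ ω, Real.exp (s * Z ω) ∂μ ≤ Real.exp (powerPhi α (a * s)))
    {a : ℝ} (h : tauPhi μ (powerPhi α) Z ≤ a) : IsPhiDominated μ α a Z := by
  refine ⟨hZ, fun s => ?_⟩
  rw [← ofReal_integral_eq_lintegral_ofReal (hint s)
    (Eventually.of_forall fun _ => Real.exp_nonneg _)]
  refine ENNReal.ofReal_le_ofReal ?_
  have hlim : Tendsto (fun r : ℝ => Real.exp (powerPhi α (s * r))) (𝓝[>] a)
      (𝓝 (Real.exp (powerPhi α (s * a)))) := by
    have hcont : Continuous (fun r : ℝ => Real.exp (powerPhi α (s * r))) :=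
      Real.continuous_exp.comp ((continuous_powerPhi hα).comp (continuous_const.mul continuous_id))
    exact hcont.continuousAt.mono_left nhdsWithin_le_nhds
  refine ge_of_tendsto hlim ?_
  filter_upwards [self_mem_nhdsWithin] with r hr
  obtain ⟨a', ⟨ha', hbd⟩, hlt⟩ := exists_lt_of_csInf_lt hne (h.trans_lt hr)
  refine (hbd s).trans (Real.exp_le_exp.2 (powerPhi_mono hα ?_))
  rw [abs_mul, abs_mul, abs_of_pos ha', abs_of_pos (ha'.trans hlt), mul_comm]
  gcongr

theorem IsPhiSubGaussian.isPhiDominated {α : ℝ} (hα : 0 < α) {Z : Ω → ℝ}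
    (hZ : IsPhiSubGaussian μ (powerPhi α) Z) {a : ℝ} (h : tauPhi μ (powerPhi α) Z ≤ a) :
    IsPhiDominated μ α a Z := by
  obtain ⟨c, hc, hb⟩ := hZ.bound
  exact isPhiDominated_of_tauPhi_le hα hZ.measurable hZ.integrable_exp
    ⟨c, hc, fun s => by rw [mul_comm c s]; exact hb s⟩ h

theorem IsPhiSubGaussian.isPhiDominated_sub {α : ℝ} (hα : 0 < α) {Y Z : Ω → ℝ}
    (hY : IsPhiSubGaussian μ (powerPhi α) Y) (hZ : IsPhiSubGaussian μ (powerPhi α) Z) {a : ℝ}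
    (h : tauPhi μ (powerPhi α) (fun ω => Y ω - Z ω) ≤ a) :
    IsPhiDominated μ α a (fun ω => Y ω - Z ω) :=
  isPhiDominated_of_tauPhi_le hα (hY.measurable.sub hZ.measurable)
    (hY.exists_bound_sub hα hZ).1 (hY.exists_bound_sub hα hZ).2 h

/-- From |z| ≤ a (exp(z/a) + exp(-z/a)). Only linearity in `a` matters later, for the summability of
first moments along a chain. -/
theorem IsPhiDominated.lintegral_enorm_le {α a : ℝ} (ha : 0 < a) {Z : Ω → ℝ}
    (hZ : IsPhiDominated μ α a Z) :
    ∫⁻ ω, ‖Z ω‖ₑ ∂μ ≤ ENNReal.ofReal a * (2 * ENNReal.ofReal (Real.exp (1 / α))) := by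
  have key : ∀ ω, ‖Z ω‖ₑ ≤ ENNReal.ofReal a * (ENNReal.ofReal (Real.exp (a⁻¹ * Z ω)) +
      ENNReal.ofReal (Real.exp (-a⁻¹ * Z ω))) := by
    intro ω
    rw [← ENNReal.ofReal_add (Real.exp_nonneg _) (Real.exp_nonneg _),
      ← ENNReal.ofReal_mul ha.le, Real.enorm_eq_ofReal_abs]
    refine ENNReal.ofReal_le_ofReal ?_
    have h1 := Real.add_one_le_exp (a⁻¹ * Z ω)
    have h2 := Real.add_one_le_exp (-a⁻¹ * Z ω)
    have h3 := Real.exp_pos (a⁻¹ * Z ω)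
    have h4 := Real.exp_pos (-a⁻¹ * Z ω)
    have h5 : a * (a⁻¹ * Z ω) = Z ω := by field_simp
    rw [abs_le]
    constructor <;> nlinarith
  have hm : Measurable fun ω => ENNReal.ofReal (Real.exp (a⁻¹ * Z ω)) :=
    (Real.measurable_exp.comp (hZ.measurable.const_mul _)).ennreal_ofReal
  refine (lintegral_mono key).trans ?_
  rw [lintegral_const_mul' _ _ ENNReal.ofReal_ne_top, lintegral_add_left hm, two_mul]
  have e1 : powerPhi α (a⁻¹ * a) = 1 / α := by
    rw [inv_mul_cancel₀ ha.ne']; simp [powerPhi]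
  have e2 : powerPhi α (-a⁻¹ * a) = 1 / α := by
    rw [neg_mul, inv_mul_cancel₀ ha.ne']; simp [powerPhi]
  gcongr
  · exact e1 ▸ hZ.lintegral_le a⁻¹
  · exact e2 ▸ hZ.lintegral_le (-a⁻¹)

/-- The exponential of the maximum is at most the sum of exponentials over all points and both
signs, whence the factor 2N. -/
theorem IsPhiDominated.exists_sup_bound {κ : Type*} {α a N : ℝ} {T : Finset κ} (hT : T.Nonempty)
    (hN : (T.card : ℝ) ≤ N) {Z : κ → Ω → ℝ} (hZ : ∀ x ∈ T, IsPhiDominated μ α a (Z x)) :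
    ∃ η : Ω → ℝ, Measurable η ∧ (∀ ω, 0 ≤ η ω) ∧ (∀ x ∈ T, ∀ ω, |Z x ω| ≤ η ω) ∧
      ∀ s : ℝ, ∫⁻ ω, ENNReal.ofReal (Real.exp (s * η ω)) ∂μ ≤
        ENNReal.ofReal (2 * N * Real.exp (powerPhi α (s * a))) := by
  refine ⟨fun ω => T.sup' hT fun x => |Z x ω|, ?_, ?_, ?_, ?_⟩
  · have h := Finset.measurable_sup' hT (f := fun x ω => |Z x ω|)
      fun x hx => (hZ x hx).measurable.abs
    convert h using 2 with ω
    rw [Finset.sup'_apply]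
  · intro ω
    obtain ⟨x, hx⟩ := hT
    exact (abs_nonneg _).trans (Finset.le_sup' (fun x => |Z x ω|) hx)
  · intro x hx ω
    exact Finset.le_sup' (fun x => |Z x ω|) hx
  · intro s
    have hm : ∀ r : ℝ, ∀ x ∈ T, Measurable fun ω => ENNReal.ofReal (Real.exp (r * Z x ω)) :=
      fun r x hx => (Real.measurable_exp.comp ((hZ x hx).measurable.const_mul _)).ennreal_ofReal
    have key : ∀ ω, ENNReal.ofReal (Real.exp (s * T.sup' hT fun x => |Z x ω|)) ≤
        ∑ x ∈ T, (ENNReal.ofReal (Real.exp (s * Z x ω)) +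
          ENNReal.ofReal (Real.exp (-s * Z x ω))) := by
      intro ω
      obtain ⟨x, hx, hxe⟩ := Finset.exists_mem_eq_sup' hT fun x => |Z x ω|
      rw [hxe]
      refine le_trans ?_ (Finset.single_le_sum (f := fun x =>
        ENNReal.ofReal (Real.exp (s * Z x ω)) + ENNReal.ofReal (Real.exp (-s * Z x ω)))
        (fun _ _ => zero_le) hx)
      rcases abs_cases (Z x ω) with ⟨h, -⟩ | ⟨h, -⟩
      · rw [h]; exact le_self_add
      · rw [h, mul_neg, ← neg_mul]; exact le_add_self
    calc ∫⁻ ω, ENNReal.ofReal (Real.exp (s * T.sup' hT fun x => |Z x ω|)) ∂μ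
        ≤ ∫⁻ ω, ∑ x ∈ T, (ENNReal.ofReal (Real.exp (s * Z x ω)) +
          ENNReal.ofReal (Real.exp (-s * Z x ω))) ∂μ := lintegral_mono key
      _ = ∑ x ∈ T, (∫⁻ ω, ENNReal.ofReal (Real.exp (s * Z x ω)) ∂μ +
          ∫⁻ ω, ENNReal.ofReal (Real.exp (-s * Z x ω)) ∂μ) := by
          have hm2 : ∀ x ∈ T, AEMeasurable (fun ω => ENNReal.ofReal (Real.exp (s * Z x ω)) +
              ENNReal.ofReal (Real.exp (-s * Z x ω))) μ :=
            fun x hx => ((hm s x hx).add (hm (-s) x hx)).aemeasurable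
          rw [lintegral_finsetSum' _ hm2]
          exact Finset.sum_congr rfl fun x hx => lintegral_add_left (hm s x hx) _
      _ ≤ ∑ x ∈ T, ENNReal.ofReal (2 * Real.exp (powerPhi α (s * a))) := by
          refine Finset.sum_le_sum fun x hx => ?_
          rw [two_mul, ENNReal.ofReal_add (Real.exp_nonneg _) (Real.exp_nonneg _)]
          refine add_le_add ((hZ x hx).lintegral_le s) (((hZ x hx).lintegral_le (-s)).trans_eq ?_)
          simp [powerPhi]
      _ ≤ _ := by
          rw [Finset.sum_const, nsmul_eq_mul, ← ENNReal.ofReal_natCast,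
            ← ENNReal.ofReal_mul (Nat.cast_nonneg _)]
          refine ENNReal.ofReal_le_ofReal ?_
          have := Real.exp_pos (powerPhi α (s * a))
          nlinarith

/-- Jensen's inequality for the exponential with weights of total mass at most one. -/
theorem exp_sum_le_of_sum_le_one {ι : Type*} (J : Finset ι) (w y : ι → ℝ)
    (hw : ∀ i ∈ J, 0 ≤ w i) (hw1 : ∑ i ∈ J, w i ≤ 1) :
    Real.exp (∑ i ∈ J, w i * y i) ≤ ∑ i ∈ J, w i * Real.exp (y i) + (1 - ∑ i ∈ J, w i) := by
  set m := ∑ i ∈ J, w i * y i with hm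
  have h1 : ∑ i ∈ J, w i * (Real.exp m * (1 + (y i - m))) ≤ ∑ i ∈ J, w i * Real.exp (y i) := by
    refine Finset.sum_le_sum fun i hi => mul_le_mul_of_nonneg_left ?_ (hw i hi)
    have h := Real.add_one_le_exp (y i - m)
    calc Real.exp m * (1 + (y i - m)) ≤ Real.exp m * Real.exp (y i - m) := by
          gcongr; linarith
      _ = Real.exp (y i) := by rw [← Real.exp_add]; congr 1; ring
  have h2 : ∑ i ∈ J, w i * (Real.exp m * (1 + (y i - m))) =
      Real.exp m * (∑ i ∈ J, w i + m - (∑ i ∈ J, w i) * m) := by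
    have : ∀ i, w i * (Real.exp m * (1 + (y i - m))) =
        Real.exp m * w i + Real.exp m * (w i * y i) - Real.exp m * m * w i := fun i => by ring
    simp only [this, Finset.sum_add_distrib, Finset.sum_sub_distrib, ← Finset.mul_sum, ← hm]
    ring
  -- The missing mass acts as an extra point at 0, where the tangent line of exp at `m` gives exp m
  -- · (1 - m) ≤ 1.
  have h3 : 0 ≤ Real.exp m * m - Real.exp m + 1 := by
    have h := Real.add_one_le_exp (-m)
    have h' : Real.exp m * Real.exp (-m) = 1 := by rw [← Real.exp_add]; simp
    nlinarith [Real.exp_pos m]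
  nlinarith

end

/-! ### Tails of sums of maxima. -/

section

variable {Ω : Type*} [MeasurableSpace Ω] {μ : Measure Ω}

/-- Splits l = l^{1/α} l^{1/β}. With l = log N it turns entropy divided by `z i` into the power 1/β
of the entropy. -/
theorem le_rpow_add_mul_rpow {α β x l : ℝ} (hα : 1 < α) (hαβ : 1 / α + 1 / β = 1)
    (hx : 0 < x) (hl : 0 ≤ l) :
    l ≤ (x ^ α + α * l) ^ (1 / α) * l ^ (1 / β) := by
  have hα0 : 0 < α := by linarith
  rcases hl.eq_or_lt with rfl | hl'
  · positivity
  · calc l = l ^ (1 / α) * l ^ (1 / β) := by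
          rw [← Real.rpow_add hl', hαβ, Real.rpow_one]
      _ ≤ _ := by
          gcongr
          nlinarith [Real.rpow_pos_of_pos hx α]

/-- A tail estimate for a finite sum of variables whose moment generating functions are bounded
by those of maxima of `N i` variables of scale `a i`. -/
theorem measure_finset_sum_gt_le [IsProbabilityMeasure μ] {ι : Type*} (J : Finset ι)
    {α β D M u : ℝ} (hα : 1 < α) (hαβ : 1 / α + 1 / β = 1)
    {Y : ι → Ω → ℝ} {a N : ι → ℝ} (hYm : ∀ i, Measurable (Y i)) (ha : ∀ i, 0 < a i)
    (hN : ∀ i, 1 ≤ N i)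
    (hE : ∀ i, ∀ s : ℝ, ∫⁻ ω, ENNReal.ofReal (Real.exp (s * Y i ω)) ∂μ ≤
      ENNReal.ofReal (2 * N i * Real.exp (powerPhi α (s * a i))))
    (hD : 0 < D) (haD : ∑ i ∈ J, a i ≤ D)
    (haM : ∑ i ∈ J, a i * Real.log (N i) ^ (1 / β) ≤ M) (hu : 2 * M < u) :
    μ {ω | u < ∑ i ∈ J, Y i ω} ≤
      ENNReal.ofReal (2 * Real.exp (-(1 / β) * ((u - 2 * M) / D) ^ β)) := by
  have hα0 : 0 < α := by linarith
  have hβ1 : 1 / β = 1 - 1 / α := by linarith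
  have hα1 : 1 / α < 1 := by rw [div_lt_one hα0]; exact hα
  have hβ0 : 0 < β := by
    have : 0 < 1 / β := by linarith
    exact one_div_pos.1 this
  have hβα : (β - 1) * α = β := by
    have := hαβ
    field_simp at this
    linarith
  set v := (u - 2 * M) / D with hv
  have hv0 : 0 < v := div_pos (by linarith) hD
  -- The maximiser of x v - x^α/α, whose maximum is the conjugate function v^β/β.
  set x := v ^ (β - 1) with hx
  have hx0 : 0 < x := Real.rpow_pos_of_pos hv0 _
  have hxα : x ^ α = v ^ β := by rw [hx, ← Real.rpow_mul hv0.le, hβα]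
  have hxv : x * v = v ^ β := by
    rw [hx, ← Real.rpow_add_one hv0.ne']; congr 1; ring
  set r := x / D with hr
  have hr0 : 0 < r := div_pos hx0 hD
  have hlog : ∀ i, 0 ≤ Real.log (N i) := fun i => Real.log_nonneg (hN i)
  -- The Jensen weights `w i` = r a_i / z_i make every coefficient of `Y i` equal to `r`. Since z_i
  -- ≥ x and r = x/D, they sum to at most 1; the log N term in z_i pays for the cardinality.
  set z : ι → ℝ := fun i => (x ^ α + α * Real.log (N i)) ^ (1 / α) with hz
  have hzx : ∀ i, x ≤ z i := by
    intro i
    calc x = (x ^ α) ^ (1 / α) := by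
          rw [← Real.rpow_mul hx0.le, mul_one_div_cancel hα0.ne', Real.rpow_one]
      _ ≤ z i := by
          simp only [hz]
          gcongr
          nlinarith [hlog i]
  have hz0 : ∀ i, 0 < z i := fun i => hx0.trans_le (hzx i)
  have hzα : ∀ i, z i ^ α = x ^ α + α * Real.log (N i) := by
    intro i
    have : 0 ≤ x ^ α + α * Real.log (N i) := by have := hlog i; positivity
    rw [hz, ← Real.rpow_mul this, one_div_mul_cancel hα0.ne', Real.rpow_one]
  set w : ι → ℝ := fun i => r * a i / z i with hw
  have hw0 : ∀ i, 0 < w i := fun i => div_pos (mul_pos hr0 (ha i)) (hz0 i)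
  have hwa : ∀ i, w i ≤ a i / D := by
    intro i
    have : r * a i = a i / D * x := by rw [hr]; ring
    simp only [hw]
    rw [div_le_iff₀ (hz0 i), this]
    have := ha i
    gcongr
    exact hzx i
  have hw1 : ∑ i ∈ J, w i ≤ 1 := by
    refine (Finset.sum_le_sum fun i _ => hwa i).trans ?_
    rw [← Finset.sum_div, div_le_one hD]
    exact haD
  -- The logarithm of the bound on E exp((z_i/a_i) Y_i), so each normalised exponential has mean at
  -- most 1.
  set ℓ : ι → ℝ := fun i => Real.log 2 + Real.log (N i) + z i ^ α / α with hℓ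
  have hEi : ∀ i, ∫⁻ ω, ENNReal.ofReal (w i * Real.exp (z i / a i * Y i ω - ℓ i)) ∂μ ≤
      ENNReal.ofReal (w i) := by
    intro i
    have e1 : ∀ ω, ENNReal.ofReal (w i * Real.exp (z i / a i * Y i ω - ℓ i)) =
        ENNReal.ofReal (w i * Real.exp (-ℓ i)) *
          ENNReal.ofReal (Real.exp (z i / a i * Y i ω)) := by
      intro ω
      rw [← ENNReal.ofReal_mul (mul_nonneg (hw0 i).le (Real.exp_nonneg _)), mul_assoc,
        ← Real.exp_add]
      congr 3
      ring
    simp_rw [e1]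
    rw [lintegral_const_mul' _ _ ENNReal.ofReal_ne_top]
    refine (mul_le_mul_right (hE i (z i / a i)) _).trans ?_
    rw [← ENNReal.ofReal_mul (mul_nonneg (hw0 i).le (Real.exp_nonneg _)),
      div_mul_cancel₀ _ (ha i).ne']
    refine ENNReal.ofReal_le_ofReal (le_of_eq ?_)
    have hNi : 0 < N i := by linarith [hN i]
    have : Real.exp (ℓ i) = 2 * N i * Real.exp (powerPhi α (z i)) := by
      simp only [hℓ, powerPhi]
      rw [Real.exp_add, Real.exp_add, Real.exp_log two_pos, Real.exp_log hNi,
        abs_of_pos (hz0 i)]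
    rw [← this, mul_assoc, ← Real.exp_add]
    simp
  have hconst : 0 ≤ 1 - ∑ i ∈ J, w i := by linarith
  have hJ : ∫⁻ ω, ENNReal.ofReal (Real.exp (∑ i ∈ J, w i * (z i / a i * Y i ω - ℓ i))) ∂μ ≤ 1 := by
    have hmeas : ∀ i ∈ J, AEMeasurable (fun ω =>
        ENNReal.ofReal (w i * Real.exp (z i / a i * Y i ω - ℓ i))) μ := fun i _ =>
      ((Real.measurable_exp.comp
        (((hYm i).const_mul _).sub_const _)).const_mul _).ennreal_ofReal.aemeasurable
    calc ∫⁻ ω, ENNReal.ofReal (Real.exp (∑ i ∈ J, w i * (z i / a i * Y i ω - ℓ i))) ∂μ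
        ≤ ∫⁻ ω, (∑ i ∈ J, ENNReal.ofReal (w i * Real.exp (z i / a i * Y i ω - ℓ i)) +
            ENNReal.ofReal (1 - ∑ i ∈ J, w i)) ∂μ := by
          refine lintegral_mono fun ω => ?_
          rw [← ENNReal.ofReal_sum_of_nonneg
            fun i _ => mul_nonneg (hw0 i).le (Real.exp_nonneg _),
            ← ENNReal.ofReal_add (Finset.sum_nonneg
              fun i _ => mul_nonneg (hw0 i).le (Real.exp_nonneg _)) hconst]
          exact ENNReal.ofReal_le_ofReal
            (exp_sum_le_of_sum_le_one J w _ (fun i _ => (hw0 i).le) hw1)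
      _ = ∑ i ∈ J, ∫⁻ ω, ENNReal.ofReal (w i * Real.exp (z i / a i * Y i ω - ℓ i)) ∂μ +
            ENNReal.ofReal (1 - ∑ i ∈ J, w i) := by
          rw [lintegral_add_right _ measurable_const, lintegral_finsetSum' _ hmeas]
          simp
      _ ≤ ∑ i ∈ J, ENNReal.ofReal (w i) + ENNReal.ofReal (1 - ∑ i ∈ J, w i) := by
          gcongr with i _
          exact hEi i
      _ = 1 := by
          rw [← ENNReal.ofReal_sum_of_nonneg fun i _ => (hw0 i).le,
            ← ENNReal.ofReal_add (Finset.sum_nonneg fun i _ => (hw0 i).le) hconst]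
          simp
  have hwl : ∑ i ∈ J, w i * ℓ i ≤ Real.log 2 + x ^ α / α + 2 * r * M := by
    have h0 : 0 ≤ Real.log 2 + x ^ α / α := by positivity
    have hi : ∀ i, w i * ℓ i ≤ w i * (Real.log 2 + x ^ α / α) +
        2 * r * (a i * Real.log (N i) ^ (1 / β)) := by
      intro i
      have e : ℓ i = Real.log 2 + x ^ α / α + 2 * Real.log (N i) := by
        simp only [hℓ, hzα]
        field_simp
        ring
      have hle : w i * Real.log (N i) ≤ r * (a i * Real.log (N i) ^ (1 / β)) := by
        simp only [hw]
        rw [div_mul_eq_mul_div, div_le_iff₀ (hz0 i)]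
        have := le_rpow_add_mul_rpow hα hαβ hx0 (hlog i)
        calc r * a i * Real.log (N i) ≤ r * a i * (z i * Real.log (N i) ^ (1 / β)) := by
              have := ha i
              gcongr
          _ = _ := by ring
      rw [e]
      linarith
    calc ∑ i ∈ J, w i * ℓ i
        ≤ (∑ i ∈ J, w i) * (Real.log 2 + x ^ α / α) +
          2 * r * ∑ i ∈ J, a i * Real.log (N i) ^ (1 / β) := by
          rw [Finset.sum_mul, Finset.mul_sum, ← Finset.sum_add_distrib]
          exact Finset.sum_le_sum fun i _ => hi i
      _ ≤ 1 * (Real.log 2 + x ^ α / α) + 2 * r * M := by gcongr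
      _ = _ := by ring
  have hsum : ∀ ω, ∑ i ∈ J, w i * (z i / a i * Y i ω - ℓ i) =
      r * ∑ i ∈ J, Y i ω - ∑ i ∈ J, w i * ℓ i := by
    intro ω
    rw [Finset.mul_sum, ← Finset.sum_sub_distrib]
    refine Finset.sum_congr rfl fun i _ => ?_
    have h1 := (ha i).ne'
    have h2 := (hz0 i).ne'
    simp only [hw]
    field_simp
  set E := Real.exp (r * u - ∑ i ∈ J, w i * ℓ i) with hEdef
  have hmarkov : ENNReal.ofReal E * μ {ω | u < ∑ i ∈ J, Y i ω} ≤ 1 := by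
    refine le_trans ?_ hJ
    refine le_trans ?_ (mul_meas_ge_le_lintegral₀ (μ := μ) ?_ (ENNReal.ofReal E))
    · gcongr with ω
      intro hω
      rw [hsum, hEdef]
      gcongr
    · exact (Real.measurable_exp.comp (Finset.measurable_fun_sum J fun i _ =>
        (((hYm i).const_mul _).sub_const _).const_mul _)).ennreal_ofReal.aemeasurable
  have hE0 : 0 < E := Real.exp_pos _
  have hfin : μ {ω | u < ∑ i ∈ J, Y i ω} ≤ ENNReal.ofReal E⁻¹ := by
    rw [ENNReal.ofReal_inv_of_pos hE0, ← one_div]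
    rw [ENNReal.le_div_iff_mul_le (Or.inl (by simpa using hE0)) (Or.inl ENNReal.ofReal_ne_top),
      mul_comm]
    exact hmarkov
  refine hfin.trans (ENNReal.ofReal_le_ofReal ?_)
  rw [hEdef, ← Real.exp_neg]
  have h2 : (2 : ℝ) * Real.exp (-(1 / β) * v ^ β) =
      Real.exp (Real.log 2 + -(1 / β) * v ^ β) := by
    rw [Real.exp_add, Real.exp_log two_pos]
  rw [h2]
  refine Real.exp_le_exp.2 ?_
  have h3 : r * (u - 2 * M) = v ^ β := by
    rw [← hxv, hr, hv]; field_simp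
  have h4 : x ^ α / α = (1 - 1 / β) * v ^ β := by
    rw [hxα, ← show 1 / α = 1 - 1 / β by linarith]; ring
  nlinarith

/-- Continuity from below along finite partial sums; with values in [0, ∞] no convergence has to be
known beforehand. -/
theorem measure_tsum_gt_le [IsProbabilityMeasure μ] {ι : Type*} [Countable ι]
    {α β D M u : ℝ} (hα : 1 < α) (hαβ : 1 / α + 1 / β = 1)
    {Y : ι → Ω → ℝ} {a N : ι → ℝ} (hYm : ∀ i, Measurable (Y i)) (hY0 : ∀ i ω, 0 ≤ Y i ω)
    (ha : ∀ i, 0 < a i) (hN : ∀ i, 1 ≤ N i)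
    (hE : ∀ i, ∀ s : ℝ, ∫⁻ ω, ENNReal.ofReal (Real.exp (s * Y i ω)) ∂μ ≤
      ENNReal.ofReal (2 * N i * Real.exp (powerPhi α (s * a i))))
    (hD : 0 < D) (haD : ∀ J : Finset ι, ∑ i ∈ J, a i ≤ D)
    (haM : ∀ J : Finset ι, ∑ i ∈ J, a i * Real.log (N i) ^ (1 / β) ≤ M) (hu : 2 * M < u) :
    μ {ω | ENNReal.ofReal u < ∑' i, ENNReal.ofReal (Y i ω)} ≤
      ENNReal.ofReal (2 * Real.exp (-(1 / β) * ((u - 2 * M) / D) ^ β)) := by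
  have hM0 : 0 ≤ M := by simpa using haM ∅
  have hu0 : 0 ≤ u := by linarith
  have hset : {ω | ENNReal.ofReal u < ∑' i, ENNReal.ofReal (Y i ω)} =
      ⋃ J : Finset ι, {ω | u < ∑ i ∈ J, Y i ω} := by
    ext ω
    simp only [mem_ofPred_eq, mem_iUnion, ENNReal.tsum_eq_iSup_sum, lt_iSup_iff]
    refine exists_congr fun J => ?_
    rw [← ENNReal.ofReal_sum_of_nonneg fun i _ => hY0 i ω, ENNReal.ofReal_lt_ofReal_iff']
    exact ⟨fun h => h.1, fun h => ⟨h, hu0.trans_lt h⟩⟩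
  rw [hset, Directed.measure_iUnion]
  · exact iSup_le fun J =>
      measure_finset_sum_gt_le J hα hαβ hYm ha hN hE hD (haD J) (haM J) hu
  · refine Monotone.directed_le fun J K hJK ω hω => ?_
    exact lt_of_lt_of_le hω (Finset.sum_le_sum_of_subset_of_nonneg hJK fun i _ _ => hY0 i ω)

theorem ae_tsum_ne_top [IsProbabilityMeasure μ] {ι : Type*} [Countable ι]
    {α β D M : ℝ} (hα : 1 < α) (hαβ : 1 / α + 1 / β = 1)
    {Y : ι → Ω → ℝ} {a N : ι → ℝ} (hYm : ∀ i, Measurable (Y i)) (hY0 : ∀ i ω, 0 ≤ Y i ω)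
    (ha : ∀ i, 0 < a i) (hN : ∀ i, 1 ≤ N i)
    (hE : ∀ i, ∀ s : ℝ, ∫⁻ ω, ENNReal.ofReal (Real.exp (s * Y i ω)) ∂μ ≤
      ENNReal.ofReal (2 * N i * Real.exp (powerPhi α (s * a i))))
    (hD : 0 < D) (haD : ∀ J : Finset ι, ∑ i ∈ J, a i ≤ D)
    (haM : ∀ J : Finset ι, ∑ i ∈ J, a i * Real.log (N i) ^ (1 / β) ≤ M) :
    ∀ᵐ ω ∂μ, ∑' i, ENNReal.ofReal (Y i ω) ≠ ⊤ := by
  have hα1 : 1 / α < 1 := by rw [div_lt_one (by linarith)]; exact hα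
  have hβ0 : 0 < β := one_div_pos.1 (by linarith)
  have hlim : Tendsto (fun u : ℝ =>
      ENNReal.ofReal (2 * Real.exp (-(1 / β) * ((u - 2 * M) / D) ^ β))) atTop (𝓝 0) := by
    have h1 : Tendsto (fun u : ℝ => (u - 2 * M) / D) atTop atTop :=
      (tendsto_atTop_add_const_right _ _ tendsto_id).atTop_div_const hD
    have h2 : Tendsto (fun u : ℝ => -(1 / β) * ((u - 2 * M) / D) ^ β) atTop atBot :=
      ((tendsto_rpow_atTop hβ0).comp h1).const_mul_atTop_of_neg (by simpa using hβ0)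
    have h3 := ENNReal.tendsto_ofReal ((Real.tendsto_exp_atBot.comp h2).const_mul 2)
    simpa using h3
  refine nonpos_iff_eq_zero.1 (ge_of_tendsto hlim ?_)
  filter_upwards [eventually_gt_atTop (2 * M)] with u hu
  refine le_trans (measure_mono fun ω hω => ?_)
    (measure_tsum_gt_le hα hαβ hYm hY0 ha hN hE hD haD haM hu)
  have : ∑' i, ENNReal.ofReal (Y i ω) = ⊤ := by simpa using hω
  simp [this]

end

/-! ### Covering numbers and entropy of rectangles. -/

theorem exists_uniform_net_of_length {h : ℝ} (hh : 0 ≤ h) (n : ℕ) (a : ℝ) :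
    ∃ T : Finset ℝ, (↑T : Set ℝ) ⊆ Icc a (a + 2 * h * (n + 1)) ∧ T.card ≤ n + 1 ∧
      ∀ x ∈ Icc a (a + 2 * h * (n + 1)), ∃ y ∈ T, |x - y| ≤ h := by
  induction n generalizing a with
  | zero =>
    refine ⟨{a + h}, ?_, by simp, ?_⟩
    · intro y hy
      have hy' : y = a + h := by simpa using hy
      subst hy'
      constructor <;> push_cast <;> linarith
    · rintro x ⟨h1, h2⟩
      push_cast at h2
      exact ⟨a + h, by simp, abs_le.2 ⟨by linarith, by linarith⟩⟩
  | succ n ih =>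
    obtain ⟨T, hT, hcard, hcov⟩ := ih (a + 2 * h)
    have hnn : 0 ≤ h * n := by positivity
    refine ⟨insert (a + h) T, ?_, (Finset.card_insert_le _ _).trans (by omega), ?_⟩
    · intro y hy
      rcases Finset.mem_insert.1 (Finset.mem_coe.1 hy) with rfl | hy
      · constructor <;> push_cast <;> nlinarith
      · obtain ⟨h1, h2⟩ := hT hy
        constructor <;> push_cast <;> nlinarith
    · rintro x ⟨h1, h2⟩
      push_cast at h2
      rcases le_total x (a + 2 * h) with hx | hx
      · exact ⟨a + h, Finset.mem_insert_self _ _, abs_le.2 ⟨by linarith, by linarith⟩⟩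
      · obtain ⟨y, hy, hxy⟩ := hcov x ⟨hx, by nlinarith⟩
        exact ⟨y, Finset.mem_insert_of_mem hy, hxy⟩

theorem exists_net_Icc {a c r : ℝ} (hac : a ≤ c) (hr : 0 < r) :
    ∃ T : Finset ℝ, (↑T : Set ℝ) ⊆ Icc a c ∧ (T.card : ℝ) ≤ 1 + (c - a) / 2 / r ∧
      ∀ x ∈ Icc a c, ∃ y ∈ T, |x - y| ≤ r := by
  set L := (c - a) / 2 with hL
  have hL0 : 0 ≤ L := by rw [hL]; linarith
  -- Using n + 1 equal cells of half-length L/(n+1) ≤ r, rather than `r` itself, keeps all centres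
  -- inside the interval.
  set n := ⌊L / r⌋₊ with hn
  have hn1 : (n : ℝ) ≤ L / r := Nat.floor_le (by positivity)
  have hn2 : L / r < n + 1 := Nat.lt_floor_add_one _
  have hn0 : (0 : ℝ) < n + 1 := by positivity
  obtain ⟨T, hT, hcard, hcov⟩ := exists_uniform_net_of_length (h := L / (n + 1)) (by positivity) n a
  have e : a + 2 * (L / (n + 1)) * (n + 1) = c := by
    rw [hL]; field_simp; ring
  rw [e] at hT hcov
  refine ⟨T, hT, ?_, fun x hx => ?_⟩
  · have : (T.card : ℝ) ≤ n + 1 := by exact_mod_cast hcard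
    linarith
  · obtain ⟨y, hy, hxy⟩ := hcov x hx
    refine ⟨y, hy, hxy.trans ?_⟩
    rw [div_lt_iff₀ hr] at hn2
    rw [div_le_iff₀ hn0]
    linarith

/-- Covering numbers of a rectangle with respect to `anisoDist`. -/
theorem exists_net_rectangle {H₁ H₂ a c A v : ℝ} (hH₁ : 0 < H₁) (hH₂ : 0 < H₂) (hac : a ≤ c)
    (hA : 0 ≤ A) (hv : 0 < v) :
    ∃ T : Finset (ℝ × ℝ), (↑T : Set (ℝ × ℝ)) ⊆ Icc a c ×ˢ Icc (-A) A ∧ T.Nonempty ∧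
      (T.card : ℝ) ≤
        (1 + (c - a) / 2 / (v / 2) ^ (1 / H₁)) * (1 + A / (v / 2) ^ (1 / H₂)) ∧
      ∀ t ∈ Icc a c ×ˢ Icc (-A) A, ∃ s ∈ T, anisoDist H₁ H₂ t s ≤ v := by
  obtain ⟨T₁, h₁, hc₁, hcov₁⟩ := exists_net_Icc hac
    (Real.rpow_pos_of_pos (half_pos hv) (1 / H₁))
  obtain ⟨T₂, h₂, hc₂, hcov₂⟩ := exists_net_Icc (show -A ≤ A by linarith)
    (Real.rpow_pos_of_pos (half_pos hv) (1 / H₂))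
  have hpow : ∀ {H y : ℝ}, 0 < H → |y| ≤ (v / 2) ^ (1 / H) → |y| ^ H ≤ v / 2 := by
    intro H y hH hy
    calc |y| ^ H ≤ ((v / 2) ^ (1 / H)) ^ H := by gcongr
      _ = v / 2 := by rw [← Real.rpow_mul (half_pos hv).le, one_div_mul_cancel hH.ne',
          Real.rpow_one]
  have hcov : ∀ t ∈ Icc a c ×ˢ Icc (-A) A, ∃ s ∈ T₁ ×ˢ T₂, anisoDist H₁ H₂ t s ≤ v := by
    rintro ⟨t₁, t₂⟩ ⟨ht₁, ht₂⟩
    obtain ⟨s₁, hs₁, hd₁⟩ := hcov₁ t₁ ht₁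
    obtain ⟨s₂, hs₂, hd₂⟩ := hcov₂ t₂ ht₂
    refine ⟨(s₁, s₂), Finset.mk_mem_product hs₁ hs₂, ?_⟩
    have := hpow hH₁ hd₁
    have := hpow hH₂ hd₂
    simp only [anisoDist]
    linarith
  refine ⟨T₁ ×ˢ T₂, ?_, ?_, ?_, hcov⟩
  · rw [Finset.coe_product]
    exact prod_mono h₁ h₂
  · obtain ⟨s, hs, -⟩ := hcov (a, A) ⟨⟨le_rfl, hac⟩, ⟨by simp; linarith, le_rfl⟩⟩
    exact ⟨s, hs⟩
  · rw [Finset.card_product, Nat.cast_mul]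
    have e : (A - -A) / 2 = A := by ring
    rw [e] at hc₂
    gcongr

/-- Combines (1+x)^H ≤ 1 + x^H with log y ≤ y - 1 at y = (1+x)^H. -/
theorem log_one_add_le_rpow_div {x H : ℝ} (hx : 0 ≤ x) (hH : 0 < H) (hH' : H ≤ 1) :
    Real.log (1 + x) ≤ 1 / H * x ^ H := by
  have h1 : 0 < 1 + x := by linarith
  have h2 : (1 + x) ^ H ≤ 1 ^ H + x ^ H :=
    Real.rpow_add_le_add_rpow zero_le_one hx hH.le hH'
  have h3 := Real.log_le_sub_one_of_pos (Real.rpow_pos_of_pos h1 H)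
  rw [Real.log_rpow h1] at h3
  rw [Real.one_rpow] at h2
  rw [one_div, ← div_eq_inv_mul, le_div_iff₀ hH]
  linarith

/-- The entropy of a rectangle with respect to `anisoDist`. -/
theorem log_net_card_rpow_le {H₁ H₂ L A v β : ℝ} (hH₁ : 0 < H₁) (hH₁' : H₁ ≤ 1)
    (hH₂ : 0 < H₂) (hH₂' : H₂ ≤ 1) (hL : 0 ≤ L) (hA : 0 ≤ A) (hv : 0 < v) (hβ : 1 ≤ β) :
    Real.log ((1 + L / (v / 2) ^ (1 / H₁)) * (1 + A / (v / 2) ^ (1 / H₂))) ^ (1 / β) ≤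
      (1 / H₁ * L ^ (H₁ / β) + 1 / H₂ * A ^ (H₂ / β)) * (2 / v) ^ (1 / β) := by
  have hβ0 : 0 < β := by linarith
  have hv2 : 0 < v / 2 := half_pos hv
  have hβi : 0 ≤ 1 / β := by positivity
  have hβi' : 1 / β ≤ 1 := by rw [div_le_one hβ0]; exact hβ
  have hterm : ∀ {H y : ℝ}, 0 < H → H ≤ 1 → 0 ≤ y →
      0 ≤ Real.log (1 + y / (v / 2) ^ (1 / H)) ∧
      Real.log (1 + y / (v / 2) ^ (1 / H)) ^ (1 / β) ≤
        1 / H * y ^ (H / β) * (2 / v) ^ (1 / β) := by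
    intro H y hH hH' hy
    have h0 : 0 ≤ y / (v / 2) ^ (1 / H) := by positivity
    have hlog : 0 ≤ Real.log (1 + y / (v / 2) ^ (1 / H)) := Real.log_nonneg (by linarith)
    have e : (y / (v / 2) ^ (1 / H)) ^ H = y ^ H * (2 / v) := by
      rw [Real.div_rpow hy (by positivity), ← Real.rpow_mul hv2.le, one_div_mul_cancel hH.ne',
        Real.rpow_one]
      field_simp
    refine ⟨hlog, ?_⟩
    calc Real.log (1 + y / (v / 2) ^ (1 / H)) ^ (1 / β)
        ≤ (1 / H * (y ^ H * (2 / v))) ^ (1 / β) := by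
          rw [← e]
          gcongr
          exact log_one_add_le_rpow_div h0 hH hH'
      _ = (1 / H) ^ (1 / β) * y ^ (H / β) * (2 / v) ^ (1 / β) := by
          rw [Real.mul_rpow (by positivity) (by positivity),
            Real.mul_rpow (by positivity) (by positivity), ← Real.rpow_mul hy, mul_one_div]
          ring
      _ ≤ _ := by
          -- The exponent 1/β on 1/H is dropped because 1/H ≥ 1 and 1/β ≤ 1.
          gcongr
          refine Real.rpow_le_self_of_one_le ?_ hβi'
          rw [le_div_iff₀ hH]; linarith
  obtain ⟨l₁, b₁⟩ := hterm hH₁ hH₁' hL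
  obtain ⟨l₂, b₂⟩ := hterm hH₂ hH₂' hA
  rw [Real.log_mul (by positivity) (by positivity), add_mul]
  exact (Real.rpow_add_le_add_rpow l₁ l₂ hβi hβi').trans (add_le_add b₁ b₂)

/-! ### Chaining. -/

section

variable {κ : Type*} {g : κ → ℝ} {T : ℕ → Set κ} {π : ℕ → κ → κ} {η : ℕ → ℝ}

theorem abs_le_sum_of_chain (h0 : ∀ x ∈ T 0, |g x| ≤ η 0)
    (hT : ∀ n, ∀ x ∈ T (n + 1), π n x ∈ T n)
    (hη : ∀ n, ∀ x ∈ T (n + 1), |g x - g (π n x)| ≤ η (n + 1)) (m : ℕ) :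
    ∀ x ∈ T m, |g x| ≤ ∑ n ∈ Finset.range (m + 1), η n := by
  induction m with
  | zero => simpa using h0
  | succ m ih =>
    intro x hx
    rw [Finset.sum_range_succ]
    have h1 := ih _ (hT m x hx)
    have h2 := hη m x hx
    have h3 : |g x| ≤ |g x - g (π m x)| + |g (π m x)| := by
      simpa using abs_add_le (g x - g (π m x)) (g (π m x))
    linarith

/-- The chain starts at the approximation π_n s and descends by successive projections; continuity
of `g` is replaced by convergence along π_n s at the single point `s`. -/
theorem ofReal_abs_le_tsum_of_chain (h0 : ∀ x ∈ T 0, |g x| ≤ η 0)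
    (hT : ∀ n, ∀ x ∈ T (n + 1), π n x ∈ T n)
    (hη : ∀ n, ∀ x ∈ T (n + 1), |g x - g (π n x)| ≤ η (n + 1)) (hη0 : ∀ n, 0 ≤ η n)
    {s : κ} (hs : ∀ n, π n s ∈ T n) (hlim : Tendsto (fun n => g s - g (π n s)) atTop (𝓝 0)) :
    ENNReal.ofReal |g s| ≤ ∑' n, ENNReal.ofReal (η n) := by
  have h : Tendsto (fun n => ENNReal.ofReal |g (π n s)|) atTop (𝓝 (ENNReal.ofReal |g s|)) := by
    refine ENNReal.tendsto_ofReal (Tendsto.abs ?_)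
    simpa using hlim.const_sub (g s)
  refine le_of_tendsto' h fun n => ?_
  refine (ENNReal.ofReal_le_ofReal (abs_le_sum_of_chain h0 hT hη n _ (hs n))).trans ?_
  rw [ENNReal.ofReal_sum_of_nonneg fun i _ => hη0 i]
  exact ENNReal.sum_le_tsum _

end

theorem sum_mul_prod_le {F G : ℕ → ℝ} (hF : ∀ k, 0 ≤ F k) (hG : ∀ n, 0 ≤ G n)
    (hFs : Summable F) (hGs : Summable G) (J : Finset (ℕ × ℕ)) :
    ∑ i ∈ J, F i.1 * G i.2 ≤ (∑' k, F k) * ∑' n, G n := by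
  calc ∑ i ∈ J, F i.1 * G i.2
      ≤ ∑ i ∈ J.image Prod.fst ×ˢ J.image Prod.snd, F i.1 * G i.2 :=
        Finset.sum_le_sum_of_subset_of_nonneg Finset.subset_product
          fun i _ _ => mul_nonneg (hF _) (hG _)
    _ = (∑ k ∈ J.image Prod.fst, F k) * ∑ n ∈ J.image Prod.snd, G n := by
        rw [Finset.sum_product, Finset.sum_mul_sum]
    _ ≤ _ := by
        gcongr
        · exact Finset.sum_nonneg fun i _ => hG i
        · exact tsum_nonneg hF
        · exact hFs.sum_le_tsum _ fun i _ => hF i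
        · exact hGs.sum_le_tsum _ fun i _ => hG i

/-- Bernoulli's inequality for exponents in [0, 1]; it compares the geometric series of ratios p^s
and p. -/
theorem mul_one_sub_le_one_sub_rpow {p s : ℝ} (hp : 0 < p) (hs : 0 ≤ s) (hs' : s ≤ 1) :
    s * (1 - p) ≤ 1 - p ^ s := by
  have h := _root_.rpow_one_add_le_one_add_mul_self (s := p - 1) (by linarith) hs hs'
  rw [add_sub_cancel] at h
  linarith

section

variable {Ω : Type*} [MeasurableSpace Ω] {μ : Measure Ω}

/-- The first moments are summable, so ∑ |Z_n| is almost surely finite. -/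
theorem ae_tendsto_zero_of_geometric {α ε p : ℝ} (hε : 0 < ε) (hp : 0 < p) (hp1 : p < 1)
    {Z : ℕ → Ω → ℝ} (hZ : ∀ n, IsPhiDominated μ α (ε * p ^ n) (Z n)) :
    ∀ᵐ ω ∂μ, Tendsto (fun n => Z n ω) atTop (𝓝 0) := by
  have hsum : ∑' n, ∫⁻ ω, ‖Z n ω‖ₑ ∂μ ≠ ⊤ := by
    have h1 : ∀ n, ∫⁻ ω, ‖Z n ω‖ₑ ∂μ ≤
        ENNReal.ofReal (ε * p ^ n) * (2 * ENNReal.ofReal (Real.exp (1 / α))) :=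
      fun n => (hZ n).lintegral_enorm_le (by positivity)
    refine ne_top_of_le_ne_top ?_ (ENNReal.tsum_le_tsum h1)
    rw [ENNReal.tsum_mul_right]
    refine ENNReal.mul_ne_top ?_ (ENNReal.mul_ne_top (by simp) ENNReal.ofReal_ne_top)
    exact ((summable_geometric_of_lt_one hp.le hp1).mul_left ε).tsum_ofReal_ne_top
  rw [← lintegral_tsum fun n => (hZ n).measurable.enorm.aemeasurable] at hsum
  have hae := ae_lt_top' (AEMeasurable.tsum fun n => (hZ n).measurable.enorm.aemeasurable) hsum
  filter_upwards [hae] with ω hω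
  have h := ENNReal.tendsto_atTop_zero_of_tsum_ne_top hω.ne
  rw [tendsto_zero_iff_enorm_tendsto_zero]
  exact h

/-- Chaining over one rectangle. -/
theorem exists_chaining_rectangle {α β γ H₁ H₂ a₀ a₁ A ε c p : ℝ} {X : ℝ × ℝ → Ω → ℝ}
    (hβ : 1 ≤ β) (hγ : 0 < γ) (hH₁ : 0 < H₁) (hH₁' : H₁ ≤ 1) (hH₂ : 0 < H₂) (hH₂' : H₂ ≤ 1)
    (ha : a₀ ≤ a₁) (hA : 0 ≤ A) (hε : 0 < ε) (hc : 0 < c) (hp : 0 < p) (hp1 : p < 1)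
    (hX : ∀ t ∈ Icc a₀ a₁ ×ˢ Icc (-A) A, IsPhiDominated μ α ε (X t))
    (hXi : ∀ h : ℝ, 0 < h → ∀ t ∈ Icc a₀ a₁ ×ˢ Icc (-A) A, ∀ s ∈ Icc a₀ a₁ ×ˢ Icc (-A) A,
      anisoDist H₁ H₂ t s ≤ h → IsPhiDominated μ α (c * h ^ γ) (fun ω => X t ω - X s ω)) :
    ∃ (η : ℕ → Ω → ℝ) (N : ℕ → ℝ), (∀ n, Measurable (η n)) ∧ (∀ n ω, 0 ≤ η n ω) ∧
      (∀ n, 1 ≤ N n) ∧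
      (∀ n, ∀ s : ℝ, ∫⁻ ω, ENNReal.ofReal (Real.exp (s * η n ω)) ∂μ ≤
        ENNReal.ofReal (2 * N n * Real.exp (powerPhi α (s * (ε * p ^ n))))) ∧
      (∀ n, Real.log (N n) ^ (1 / β) ≤
        (1 / H₁ * ((a₁ - a₀) / 2) ^ (H₁ / β) + 1 / H₂ * A ^ (H₂ / β)) *
          (2 ^ (1 / β) * c ^ (1 / (γ * β))) * (ε * p ^ (n + 1)) ^ (-(1 / (γ * β)))) ∧
      ∀ s ∈ Icc a₀ a₁ ×ˢ Icc (-A) A, ∀ᵐ ω ∂μ,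
        ENNReal.ofReal |X s ω| ≤ ∑' n, ENNReal.ofReal (η n ω) := by
  set B := Icc a₀ a₁ ×ˢ Icc (-A) A with hB
  -- The radius solves c v_n^γ = ε p^{n+1}. The shift arises because links from level n+1 to level n
  -- have length at most v_n; it later costs the factor p^{-1/(γβ)}.
  set v : ℕ → ℝ := fun n => (ε * p ^ (n + 1) / c) ^ (1 / γ) with hv
  have hv0 : ∀ n, 0 < v n := fun n => by simp only [hv]; positivity
  have hvγ : ∀ n, c * v n ^ γ = ε * p ^ (n + 1) := by
    intro n
    simp only [hv]
    rw [← Real.rpow_mul (by positivity), one_div_mul_cancel hγ.ne', Real.rpow_one]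
    field_simp
  choose T hTB hTne hTcard hTcov using fun n =>
    exists_net_rectangle hH₁ hH₂ ha hA (hv0 n)
  have hproj : ∀ n t, ∃ s, t ∈ B → s ∈ T n ∧ anisoDist H₁ H₂ t s ≤ v n := by
    intro n t
    by_cases ht : t ∈ B
    · obtain ⟨s, hs⟩ := hTcov n t ht
      exact ⟨s, fun _ => hs⟩
    · exact ⟨t, fun h => absurd h ht⟩
  choose π hπ using hproj
  set N : ℕ → ℝ := fun n => (1 + (a₁ - a₀) / 2 / (v n / 2) ^ (1 / H₁)) *
    (1 + A / (v n / 2) ^ (1 / H₂)) with hN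
  have hL : 0 ≤ (a₁ - a₀) / 2 := by linarith
  have hdiff : ∀ n, ∀ t ∈ B, IsPhiDominated μ α (ε * p ^ (n + 1))
      (fun ω => X t ω - X (π n t) ω) := by
    intro n t ht
    rw [← hvγ n]
    exact hXi _ (hv0 n) t ht _ (hTB n (hπ n t ht).1) (hπ n t ht).2
  -- Level 0 carries the field itself at scale ε, later levels carry the links, so one maximal bound
  -- serves all levels.
  obtain ⟨Z, hZ0, hZs⟩ : ∃ Z : ℕ → ℝ × ℝ → Ω → ℝ, (∀ x ω, Z 0 x ω = X x ω) ∧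
      ∀ m x ω, Z (m + 1) x ω = X x ω - X (π m x) ω :=
    ⟨fun n => Nat.casesOn n X fun m x ω => X x ω - X (π m x) ω, fun _ _ => rfl, fun _ _ _ => rfl⟩
  have hη : ∀ n, ∃ η : Ω → ℝ, Measurable η ∧ (∀ ω, 0 ≤ η ω) ∧
      (∀ x ∈ T n, ∀ ω, |Z n x ω| ≤ η ω) ∧
      ∀ s : ℝ, ∫⁻ ω, ENNReal.ofReal (Real.exp (s * η ω)) ∂μ ≤
        ENNReal.ofReal (2 * N n * Real.exp (powerPhi α (s * (ε * p ^ n)))) := by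
    intro n
    refine IsPhiDominated.exists_sup_bound (hTne n) (hTcard n) fun x hx => ?_
    cases n with
    | zero =>
      rw [funext (hZ0 x), pow_zero, mul_one]
      exact hX x (hTB 0 hx)
    | succ m =>
      rw [funext (hZs m x)]
      exact hdiff m x (hTB _ hx)
  choose η hηm hη0 hηle hηE using hη
  refine ⟨η, N, hηm, hη0, fun n => ?_, hηE, fun n => ?_, fun s hs => ?_⟩
  · have h1 : 0 ≤ (a₁ - a₀) / 2 / (v n / 2) ^ (1 / H₁) := by have := hv0 n; positivity
    have h2 : 0 ≤ A / (v n / 2) ^ (1 / H₂) := by have := hv0 n; positivity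
    simp only [hN]
    nlinarith
  · refine (log_net_card_rpow_le hH₁ hH₁' hH₂ hH₂' hL hA (hv0 n) hβ).trans (le_of_eq ?_)
    rw [mul_assoc]
    congr 1
    have he : 0 < ε * p ^ (n + 1) := by positivity
    rw [Real.div_rpow two_pos.le (hv0 n).le, mul_assoc, div_eq_mul_inv]
    congr 1
    simp only [hv]
    rw [← Real.rpow_mul (by positivity), Real.div_rpow he.le hc.le, inv_div,
      Real.rpow_neg he.le, div_eq_mul_inv, show 1 / γ * (1 / β) = 1 / (γ * β) by
        rw [one_div_mul_one_div]]
  · have hlim := ae_tendsto_zero_of_geometric (ε := ε * p) (by positivity) hp hp1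
      (Z := fun n ω => X s ω - X (π n s) ω) fun n => by
        have := hdiff n s hs
        rwa [pow_succ', ← mul_assoc] at this
    filter_upwards [hlim] with ω hω
    exact ofReal_abs_le_tsum_of_chain (g := fun t => X t ω) (T := fun n => (T n : Set (ℝ × ℝ)))
      (π := π) (fun x hx => hZ0 x ω ▸ hηle 0 x hx ω) (fun n x hx => (hπ n x (hTB _ hx)).1)
      (fun n x hx => hZs n x ω ▸ hηle (n + 1) x hx ω) (fun n => hη0 n ω) (fun n => (hπ n s hs).1) hω

/-! ### Blocks and separability. -/

theorem exists_mem_stripBlock {A : ℝ} {b : ℕ → ℝ} (hb0 : b 0 = 0)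
    (hb_lim : Tendsto b atTop atTop) {t : ℝ × ℝ} (ht : t ∈ halfStrip A) :
    ∃ k, t ∈ stripBlock A b k := by
  classical
  have hex : ∃ n, t.1 < b n := (hb_lim.eventually_gt_atTop t.1).exists
  have hfind := Nat.find_spec hex
  have hmin := fun m => Nat.find_min hex (m := m)
  obtain ⟨k, hk⟩ : ∃ k, Nat.find hex = k + 1 := by
    refine Nat.exists_eq_succ_of_ne_zero fun h => ?_
    rw [h, hb0] at hfind
    exact absurd ht.1 (not_le.2 hfind)
  rw [hk] at hfind
  exact ⟨k, ⟨not_lt.1 (hmin k (by omega)), hfind.le⟩, ht.2⟩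

theorem stripBlock_subset_halfStrip {A : ℝ} {b : ℕ → ℝ} (hb0 : b 0 = 0) (hb : StrictMono b)
    (k : ℕ) : stripBlock A b k ⊆ halfStrip A :=
  prod_mono (fun _ hx => le_trans (hb0 ▸ hb.monotone (Nat.zero_le k)) hx.1) subset_rfl

/-- The normed supremum of a separable field is dominated by one random variable. -/
theorem exists_majorant_of_separable {A : ℝ} {f : ℝ → ℝ}
    (hf_pos : ∀ t, 0 ≤ t → 0 < f t) (hf_cont : ContinuousOn f (Ici 0)) {X : ℝ × ℝ → Ω → ℝ}
    (hXm : ∀ t ∈ halfStrip A, Measurable (X t)) (hX_sep : IsSeparableField μ (halfStrip A) X) :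
    ∃ Ψ : Ω → ENNReal, Measurable Ψ ∧
      (∀ᵐ ω ∂μ, Ψ ω ≠ ⊤ → ∀ t ∈ halfStrip A, |X t ω| ≤ f t.1 * (Ψ ω).toReal) ∧
      ∀ Φ : Ω → ENNReal,
        (∀ t ∈ halfStrip A, ∀ᵐ ω ∂μ, ENNReal.ofReal (|X t ω| / f t.1) ≤ Φ ω) →
          ∀ᵐ ω ∂μ, Ψ ω ≤ Φ ω := by
  obtain ⟨S, hSc, hST, -, hS⟩ := hX_sep
  refine ⟨fun ω => ⨆ s ∈ S, ENNReal.ofReal (|X s ω| / f s.1), ?_, ?_, ?_⟩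
  · exact Measurable.biSup S hSc fun s hs => ((hXm s (hST hs)).abs.div_const _).ennreal_ofReal
  · filter_upwards [hS] with ω hω hfin t ht
    set x := (⨆ s ∈ S, ENNReal.ofReal (|X s ω| / f s.1)).toReal with hx
    have hx0 : 0 ≤ x := ENNReal.toReal_nonneg
    have hSx : ∀ s ∈ S, |X s ω| ≤ f s.1 * x := by
      intro s hs
      have h1 : ENNReal.ofReal (|X s ω| / f s.1) ≤ ⨆ s ∈ S, ENNReal.ofReal (|X s ω| / f s.1) :=
        le_iSup₂ (f := fun s _ => ENNReal.ofReal (|X s ω| / f s.1)) s hs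
      have hfs := hf_pos s.1 (hST hs).1
      have h2 := ENNReal.toReal_mono hfin h1
      rw [ENNReal.toReal_ofReal (div_nonneg (abs_nonneg _) hfs.le), div_le_iff₀ hfs] at h2
      rw [mul_comm]
      exact h2
    -- By continuity f < r near t₁, so |X| ≤ r x on nearby points of `S`; separability with F =
    -- [-rx, rx] carries this to `t`, and then r decreases to f(t₁).
    have hr : ∀ r, f t.1 < r → |X t ω| ≤ r * x := by
      intro r hr
      have hev : ∀ᶠ y in 𝓝[Ici 0] t.1, f y < r := (hf_cont t.1 ht.1).eventually_lt_const hr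
      obtain ⟨U, hU, hUo⟩ := eventually_nhdsWithin_iff.1 hev |> eventually_nhds_iff.1
      have hG : IsOpen (Prod.fst ⁻¹' U : Set (ℝ × ℝ)) := hUo.1.preimage continuous_fst
      have := hω (Icc (-(r * x)) (r * x)) isClosed_Icc _ hG (fun s hs => by
        refine abs_le.1 ((hSx s hs.2).trans ?_)
        have := hU s.1 hs.1 (hST hs.2).1
        gcongr) t ⟨hUo.2, ht⟩
      exact abs_le.2 this
    have hlim : Tendsto (fun r : ℝ => r * x) (𝓝[>] f t.1) (𝓝 (f t.1 * x)) :=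
      ((continuous_id.mul continuous_const).tendsto _).mono_left nhdsWithin_le_nhds
    exact ge_of_tendsto hlim (by filter_upwards [self_mem_nhdsWithin] with r h using hr r h)
  -- The null sets in the hypothesis may depend on the point; countability of `S` merges them.
  · intro Φ hΦ
    filter_upwards [(ae_ball_iff hSc).2 fun s hs => hΦ s (hST hs)] with ω hω
    exact iSup₂_le hω

end

/-! ### Summation over the blocks. -/

section

variable {Ω : Type*} [MeasurableSpace Ω] {μ : Measure Ω}

theorem growthCTerm_pos {δ : ℝ} {b : ℕ → ℝ} {f : ℝ → ℝ} (hb0 : b 0 = 0) (hb : StrictMono b)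
    (hf_pos : ∀ t, 0 ≤ t → 0 < f t) (k : ℕ) : 0 < growthCTerm δ b f k := by
  have h1 : 0 ≤ b k := hb0 ▸ hb.monotone (Nat.zero_le k)
  have h2 : 0 < b (k + 1) := h1.trans_lt (hb (Nat.lt_succ_self k))
  exact div_pos (Real.rpow_pos_of_pos h2 _) (hf_pos _ h1)

theorem growthC_pos {cδ δ : ℝ} {b : ℕ → ℝ} {f : ℝ → ℝ} (hcδ : 0 < cδ) (hb0 : b 0 = 0)
    (hb : StrictMono b) (hf_pos : ∀ t, 0 ≤ t → 0 < f t) (hC : Summable (growthCTerm δ b f)) :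
    0 < growthC cδ δ b f :=
  mul_pos hcδ (hC.tsum_pos (fun k => (growthCTerm_pos hb0 hb hf_pos k).le) 0
    (growthCTerm_pos hb0 hb hf_pos 0))

theorem growthSTerm_nonneg {δ H₁ H₂ A γ β : ℝ} {b c : ℕ → ℝ} {f : ℝ → ℝ} (hH₁ : 0 < H₁)
    (hH₂ : 0 < H₂) (hA : 0 ≤ A) (hγβ : 1 < γ * β) (hb0 : b 0 = 0) (hb : StrictMono b)
    (hc : ∀ k, 0 < c k) (hf_pos : ∀ t, 0 ≤ t → 0 < f t) (k : ℕ) :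
    0 ≤ growthSTerm δ H₁ H₂ A γ β b c f k := by
  have h1 : 0 ≤ b k := hb0 ▸ hb.monotone (Nat.zero_le k)
  have h3 := hb (Nat.lt_succ_self k)
  have h2 : 0 ≤ b (k + 1) := h1.trans h3.le
  have h4 := hf_pos _ h1
  have h5 : 0 ≤ (b (k + 1) - b k) / 2 := by linarith
  have h6 := hc k
  have h7 : 0 < 1 - 1 / (γ * β) := by
    rw [sub_pos, div_lt_one (by linarith)]; exact hγβ
  unfold growthSTerm blockConst
  positivity

theorem growthS_nonneg {cδ δ H₁ H₂ A γ β : ℝ} {b c : ℕ → ℝ} {f : ℝ → ℝ} (hcδ : 0 < cδ)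
    (hH₁ : 0 < H₁) (hH₂ : 0 < H₂) (hA : 0 ≤ A) (hγβ : 1 < γ * β) (hb0 : b 0 = 0)
    (hb : StrictMono b) (hc : ∀ k, 0 < c k) (hf_pos : ∀ t, 0 ≤ t → 0 < f t) :
    0 ≤ growthS cδ δ H₁ H₂ A γ β b c f :=
  mul_nonneg (by positivity)
    (tsum_nonneg fun k => growthSTerm_nonneg hH₁ hH₂ hA hγβ hb0 hb hc hf_pos k)

/-- Chaining over all the blocks at once with geometric ratio `p`. -/
theorem exists_tail_majorant [IsProbabilityMeasure μ]
    {α β γ δ cδ H₁ H₂ A p : ℝ} (hα : 1 < α) (hαβ : 1 / α + 1 / β = 1) (hβ : 1 ≤ β)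
    (hγ : 0 < γ) (hγβ : 1 < γ * β) (hδ : 0 < δ) (hcδ : 0 < cδ)
    (hH₁ : 0 < H₁) (hH₁' : H₁ ≤ 1) (hH₂ : 0 < H₂) (hH₂' : H₂ ≤ 1) (hA : 0 ≤ A)
    {f : ℝ → ℝ} (hf_pos : ∀ t, 0 ≤ t → 0 < f t) (hf_mono : StrictMonoOn f (Ici 0))
    {b : ℕ → ℝ} (hb0 : b 0 = 0) (hb_mono : StrictMono b) (hb_lim : Tendsto b atTop atTop)
    {c : ℕ → ℝ} (hc : ∀ k, 0 < c k) {X : ℝ × ℝ → Ω → ℝ}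
    (hX : ∀ t ∈ halfStrip A, IsPhiSubGaussian μ (powerPhi α) (X t))
    (hX_incr : ∀ k, ∀ h : ℝ, 0 < h → ∀ t ∈ stripBlock A b k, ∀ s ∈ stripBlock A b k,
      anisoDist H₁ H₂ t s ≤ h →
        tauPhi μ (powerPhi α) (fun ω => X t ω - X s ω) ≤ c k * h ^ γ)
    (hX_growth : ∀ t ∈ halfStrip A, tauPhi μ (powerPhi α) (X t) ≤ cδ * t.1 ^ δ)
    (hC : Summable (growthCTerm δ b f)) (hS : Summable (growthSTerm δ H₁ H₂ A γ β b c f))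
    (hp : 0 < p) (hp1 : p < 1) :
    ∃ Φ : Ω → ENNReal,
      (∀ t ∈ halfStrip A, ∀ᵐ ω ∂μ, ENNReal.ofReal (|X t ω| / f t.1) ≤ Φ ω) ∧
      (∀ᵐ ω ∂μ, Φ ω ≠ ⊤) ∧
      ∀ u : ℝ,
        2 * (growthS cδ δ H₁ H₂ A γ β b c f * (p ^ (-(1 / (γ * β))) / (1 - p))) < u →
        μ {ω | ENNReal.ofReal u < Φ ω} ≤
          ENNReal.ofReal (2 * Real.exp (-(1 / β) *
            ((u - 2 * (growthS cδ δ H₁ H₂ A γ β b c f * (p ^ (-(1 / (γ * β))) / (1 - p)))) /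
              (growthC cδ δ b f * (1 - p)⁻¹)) ^ β)) := by
  have hα0 : 0 < α := by linarith
  have hp1' : 0 < 1 - p := by linarith
  have hbk : ∀ k, 0 ≤ b k := fun k => hb0 ▸ hb_mono.monotone (Nat.zero_le k)
  have hbk1 : ∀ k, 0 < b (k + 1) := fun k => (hbk k).trans_lt (hb_mono (Nat.lt_succ_self k))
  have hfk : ∀ k, 0 < f (b k) := fun k => hf_pos _ (hbk k)
  set θ := 1 / (γ * β) with hθ
  have hθ0 : 0 < θ := by simp only [hθ]; exact one_div_pos.2 (by linarith)
  have hθ1 : θ < 1 := by rw [hθ, div_lt_one (by linarith)]; exact hγβ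
  set ε : ℕ → ℝ := fun k => cδ * b (k + 1) ^ δ with hεdef
  have hε : ∀ k, 0 < ε k := fun k => mul_pos hcδ (Real.rpow_pos_of_pos (hbk1 k) _)
  have hsub := fun k => stripBlock_subset_halfStrip (A := A) hb0 hb_mono k
  have hchain := fun k => exists_chaining_rectangle (μ := μ) (α := α) (X := X) hβ hγ hH₁ hH₁' hH₂
    hH₂' (hb_mono (Nat.lt_succ_self k)).le hA (hε k) (hc k) hp hp1
    (fun t ht => (hX t (hsub k ht)).isPhiDominated hα0
      ((hX_growth t (hsub k ht)).trans (by
        have h1 : t.1 ≤ b (k + 1) := ht.1.2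
        have h2 : 0 ≤ t.1 := (hsub k ht).1
        simp only [hεdef]
        gcongr)))
    (fun h hh t ht s hs hd => (hX t (hsub k ht)).isPhiDominated_sub hα0 (hX s (hsub k hs))
      (hX_incr k h hh t ht s hs hd))
  choose η N hηm hη0 hN hηE hlogN hηX using hchain
  set Y : ℕ × ℕ → Ω → ℝ := fun i ω => η i.1 i.2 ω / f (b i.1) with hY
  set a : ℕ × ℕ → ℝ := fun i => ε i.1 * p ^ i.2 / f (b i.1) with hadef
  have hYm : ∀ i, Measurable (Y i) := fun i => (hηm _ _).div_const _
  have hY0 : ∀ i ω, 0 ≤ Y i ω := fun i ω => div_nonneg (hη0 _ _ _) (hfk _).le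
  have ha : ∀ i, 0 < a i := fun i => div_pos (mul_pos (hε _) (pow_pos hp _)) (hfk _)
  have hE : ∀ i : ℕ × ℕ, ∀ s : ℝ, ∫⁻ ω, ENNReal.ofReal (Real.exp (s * Y i ω)) ∂μ ≤
      ENNReal.ofReal (2 * N i.1 i.2 * Real.exp (powerPhi α (s * a i))) := by
    intro i s
    have h := hηE i.1 i.2 (s / f (b i.1))
    have e1 : ∀ ω, s / f (b i.1) * η i.1 i.2 ω = s * Y i ω := fun ω => by simp only [hY]; ring
    have e2 : s / f (b i.1) * (ε i.1 * p ^ i.2) = s * a i := by simp only [hadef]; ring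
    simpa only [e1, e2] using h
  have hCpos := growthC_pos hcδ hb0 hb_mono hf_pos hC
  have hD : 0 < growthC cδ δ b f * (1 - p)⁻¹ := by positivity
  have haD : ∀ J : Finset (ℕ × ℕ), ∑ i ∈ J, a i ≤ growthC cδ δ b f * (1 - p)⁻¹ := by
    intro J
    have h := sum_mul_prod_le (F := fun k => cδ * growthCTerm δ b f k) (G := fun n => p ^ n)
      (fun k => mul_nonneg hcδ.le (growthCTerm_pos hb0 hb_mono hf_pos k).le)
      (fun n => (pow_pos hp n).le) (hC.mul_left _) (summable_geometric_of_lt_one hp.le hp1) J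
    rw [tsum_mul_left, tsum_geometric_of_lt_one hp.le hp1] at h
    refine le_trans (le_of_eq (Finset.sum_congr rfl fun i _ => ?_)) h
    simp only [hadef, hεdef, growthCTerm]
    ring
  have hSnn := growthS_nonneg (δ := δ) hcδ hH₁ hH₂ hA hγβ hb0 hb_mono hc hf_pos
  set ρ := p ^ (1 - θ) with hρ
  have hρ0 : 0 < ρ := Real.rpow_pos_of_pos hp _
  have hρ1 : ρ < 1 := Real.rpow_lt_one hp.le hp1 (by linarith)
  have haM : ∀ J : Finset (ℕ × ℕ), ∑ i ∈ J, a i * Real.log (N i.1 i.2) ^ (1 / β) ≤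
      growthS cδ δ H₁ H₂ A γ β b c f * (p ^ (-θ) / (1 - p)) := by
    intro J
    -- The factor 1 - θ cancels the denominator 1 - 1/(γβ) in `blockConst`, and is spent in `h6` to
    -- replace 1/(1-ρ) by 1/(1-p).
    set F : ℕ → ℝ := fun k =>
      (1 - θ) * (cδ ^ (1 - θ) * growthSTerm δ H₁ H₂ A γ β b c f k) with hF
    have hFnn : ∀ k, 0 ≤ F k := fun k => by
      have h1 := growthSTerm_nonneg (δ := δ) hH₁ hH₂ hA hγβ hb0 hb_mono hc hf_pos k
      have h2 : 0 ≤ 1 - θ := by linarith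
      simp only [hF]
      positivity
    have h := sum_mul_prod_le (F := F) (G := fun n => p ^ (-θ) * ρ ^ n) hFnn
      (fun n => by positivity) ((hS.mul_left _).mul_left _)
      ((summable_geometric_of_lt_one hρ0.le hρ1).mul_left _) J
    have hterm : ∀ i : ℕ × ℕ, a i * Real.log (N i.1 i.2) ^ (1 / β) ≤
        F i.1 * (p ^ (-θ) * ρ ^ i.2) := by
      rintro ⟨k, n⟩
      refine (mul_le_mul_of_nonneg_left (hlogN k n) (ha (k, n)).le).trans (le_of_eq ?_)
      have h1 : (ε k * p ^ (n + 1)) ^ (-θ) = ε k ^ (-θ) * (p ^ (-θ) * (p ^ n) ^ (-θ)) := by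
        rw [pow_succ', Real.mul_rpow (hε k).le (by positivity),
          Real.mul_rpow hp.le (by positivity)]
      have h2 : ε k * ε k ^ (-θ) = cδ ^ (1 - θ) * b (k + 1) ^ (δ * (1 - θ)) := by
        rw [← Real.rpow_one_add' (hε k).le (by linarith), ← sub_eq_add_neg]
        simp only [hεdef]
        rw [Real.mul_rpow hcδ.le (Real.rpow_nonneg (hbk1 k).le _), ← Real.rpow_mul (hbk1 k).le]
      have h3 : p ^ n * (p ^ n) ^ (-θ) = ρ ^ n := by
        rw [← Real.rpow_one_add' (by positivity) (by linarith), ← sub_eq_add_neg, hρ,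
          ← Real.rpow_natCast, ← Real.rpow_natCast, ← Real.rpow_mul hp.le,
          ← Real.rpow_mul hp.le, mul_comm]
      have h4 : 1 - θ ≠ 0 := by linarith
      simp only [hF, hadef, growthSTerm, blockConst, ← hθ, h1]
      rw [← h3]
      have h5 : ∀ K L : ℝ, ε k * p ^ n / f (b k) *
          (K * L * (ε k ^ (-θ) * (p ^ (-θ) * (p ^ n) ^ (-θ)))) =
          K * L / f (b k) * (ε k * ε k ^ (-θ)) * (p ^ (-θ) * (p ^ n * (p ^ n) ^ (-θ))) :=
        fun K L => by ring
      rw [h5, h2]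
      field_simp
    refine (Finset.sum_le_sum fun i _ => hterm i).trans (h.trans ?_)
    rw [tsum_mul_left, tsum_mul_left, tsum_mul_left, tsum_geometric_of_lt_one hρ0.le hρ1]
    have hB := mul_one_sub_le_one_sub_rpow (p := p) (s := 1 - θ) hp (by linarith) (by linarith)
    change (1 - θ) * growthS cδ δ H₁ H₂ A γ β b c f * _ ≤ _
    have h6 : (1 - θ) * (1 - ρ)⁻¹ ≤ (1 - p)⁻¹ := by
      rw [← div_eq_mul_inv, ← one_div, div_le_div_iff₀ (by linarith) hp1']
      linarith
    calc (1 - θ) * growthS cδ δ H₁ H₂ A γ β b c f * (p ^ (-θ) * (1 - ρ)⁻¹)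
        = growthS cδ δ H₁ H₂ A γ β b c f * (p ^ (-θ) * ((1 - θ) * (1 - ρ)⁻¹)) := by ring
      _ ≤ growthS cδ δ H₁ H₂ A γ β b c f * (p ^ (-θ) * (1 - p)⁻¹) := by gcongr
      _ = _ := by rw [div_eq_mul_inv]
  refine ⟨fun ω => ∑' i, ENNReal.ofReal (Y i ω), fun t ht => ?_, ?_, fun u hu => ?_⟩
  · obtain ⟨k, hk⟩ := exists_mem_stripBlock hb0 hb_lim ht
    filter_upwards [hηX k t hk] with ω hω
    have hft : f (b k) ≤ f t.1 := hf_mono.monotoneOn (hbk k) ht.1 hk.1.1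
    calc ENNReal.ofReal (|X t ω| / f t.1) ≤ ENNReal.ofReal ((f (b k))⁻¹ * |X t ω|) := by
          rw [← div_eq_inv_mul]
          have := hfk k
          gcongr
      _ = ENNReal.ofReal (f (b k))⁻¹ * ENNReal.ofReal |X t ω| :=
          ENNReal.ofReal_mul (inv_nonneg.2 (hfk k).le)
      _ ≤ ENNReal.ofReal (f (b k))⁻¹ * ∑' n, ENNReal.ofReal (η k n ω) := by gcongr
      _ = ∑' n, ENNReal.ofReal (Y (k, n) ω) := by
          rw [← ENNReal.tsum_mul_left]
          refine tsum_congr fun n => ?_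
          rw [← ENNReal.ofReal_mul (inv_nonneg.2 (hfk k).le), ← div_eq_inv_mul]
      _ ≤ ∑' i, ENNReal.ofReal (Y i ω) := by
          exact ENNReal.tsum_comp_le_tsum_of_injective (f := fun n : ℕ => (k, n))
            (fun m n h => (Prod.mk.inj h).2) (fun i => ENNReal.ofReal (Y i ω))
  · exact ae_tsum_ne_top hα hαβ hYm hY0 ha (fun i => hN i.1 i.2) hE hD haD haM
  · exact measure_tsum_gt_le hα hαβ hYm hY0 ha (fun i => hN i.1 i.2) hE hD haD haM hu

end

/-! ### Choice of the ratio and the final bound. -/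

theorem mainTheorem4 {Ω : Type*} [MeasurableSpace Ω] (μ : Measure Ω) [IsProbabilityMeasure μ]
    (α β γ δ cδ H₁ H₂ A : ℝ)
    (hα : 1 < α) (hα' : α ≤ 2) (hβ : β = α / (α - 1))
    (hγ : 0 < γ) (hγ' : γ ≤ 1) (hγβ : 1 < γ * β)
    (hδ : 0 < δ) (hcδ : 0 < cδ)
    (hH₁ : 0 < H₁) (hH₁' : H₁ ≤ 1) (hH₂ : 0 < H₂) (hH₂' : H₂ ≤ 1)
    (hA : 0 ≤ A)
    (f : ℝ → ℝ) (hf_pos : ∀ t, 0 ≤ t → 0 < f t) (hf_cont : ContinuousOn f (Ici 0))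
    (hf_mono : StrictMonoOn f (Ici 0)) (hf_lim : Tendsto f atTop atTop)
    (b : ℕ → ℝ) (hb0 : b 0 = 0) (hb_mono : StrictMono b) (hb_lim : Tendsto b atTop atTop)
    (c : ℕ → ℝ) (hc : ∀ k, 0 < c k)
    (X : ℝ × ℝ → Ω → ℝ)
    (hX : ∀ t ∈ halfStrip A, IsPhiSubGaussian μ (powerPhi α) (X t))
    (hX_sep : IsSeparableField μ (halfStrip A) X)
    (hX_incr : ∀ k, ∀ h : ℝ, 0 < h → ∀ t ∈ stripBlock A b k, ∀ s ∈ stripBlock A b k,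
      anisoDist H₁ H₂ t s ≤ h →
        tauPhi μ (powerPhi α) (fun ω => X t ω - X s ω) ≤ c k * h ^ γ)
    (hX_growth : ∀ t ∈ halfStrip A, tauPhi μ (powerPhi α) (X t) ≤ cδ * t.1 ^ δ)
    (hC : Summable (growthCTerm δ b f))
    (hS : Summable (growthSTerm δ H₁ H₂ A γ β b c f)) :
    ∃ ξ : Ω → ℝ, Measurable ξ ∧
      (∀ᵐ ω ∂μ, ∀ t ∈ halfStrip A, |X t ω| ≤ f t.1 * ξ ω) ∧
      ∀ u : ℝ, (1 + 2 * growthS cδ δ H₁ H₂ A γ β b c f) ^ ((γ * β + 1) / (γ * β)) < u →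
        μ.real {ω | u < ξ ω} ≤
          2 * Real.exp (-(1 / (β * growthC cδ δ b f ^ β)) *
            (u - u ^ (1 / (γ * β + 1)) *
              (1 + 2 * growthS cδ δ H₁ H₂ A γ β b c f)) ^ β) := by
  have hα0 : 0 < α := by linarith
  have hα1 : 0 < α - 1 := by linarith
  have hαβ : 1 / α + 1 / β = 1 := by rw [hβ]; field_simp; ring
  have hβ1 : 1 ≤ β := by rw [hβ, le_div_iff₀ hα1]; linarith
  have hβ0 : 0 < β := by linarith
  have tail := fun p (hp : 0 < p) (hp1 : p < 1) =>
    exists_tail_majorant hα hαβ hβ1 hγ hγβ hδ hcδ hH₁ hH₁' hH₂ hH₂' hA hf_pos hf_mono hb0 hb_mono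
      hb_lim hc hX hX_incr hX_growth hC hS (p := p) hp hp1
  have hCpos := growthC_pos hcδ hb0 hb_mono hf_pos hC
  have hSnn := growthS_nonneg (δ := δ) hcδ hH₁ hH₂ hA hγβ hb0 hb_mono hc hf_pos
  obtain ⟨Ψ, hΨm, hΨX, hΨle⟩ :=
    exists_majorant_of_separable hf_pos hf_cont (fun t ht => (hX t ht).measurable) hX_sep
  have hΨtop : ∀ᵐ ω ∂μ, Ψ ω ≠ ⊤ := by
    -- Any ratio in (0, 1) would do for finiteness.
    obtain ⟨Φ, h1, h2, -⟩ := tail (1 / 2) (by norm_num) (by norm_num)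
    filter_upwards [hΨle Φ h1, h2] with ω hω hω'
    exact ne_top_of_le_ne_top hω' hω
  refine ⟨fun ω => (Ψ ω).toReal, hΨm.ennreal_toReal, ?_, fun u hu => ?_⟩
  · filter_upwards [hΨX, hΨtop] with ω h1 h2 using h1 h2
  set S := growthS cδ δ H₁ H₂ A γ β b c f with hSdef
  set C := growthC cδ δ b f with hCdef
  set q := γ * β with hq
  have hq0 : 0 < q := by linarith
  have hu1 : 1 < u := by
    refine lt_of_le_of_lt (Real.one_le_rpow (by linarith) ?_) hu
    positivity
  have hu0 : 0 < u := by linarith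
  set y := u ^ (1 / (q + 1)) with hy
  have hy0 : 0 < y := Real.rpow_pos_of_pos hu0 _
  -- This ratio balances the two losses: u p and p^{-1/q} both equal y = u^{1/(q+1)}.
  set p := u ^ (-(q / (q + 1))) with hp
  have hp0 : 0 < p := Real.rpow_pos_of_pos hu0 _
  have hp1 : p < 1 := Real.rpow_lt_one_of_one_lt_of_neg hu1 (by
    have : 0 < q / (q + 1) := by positivity
    linarith)
  have hp1' : 0 < 1 - p := by linarith
  have hpy : p ^ (-(1 / q)) = y := by
    rw [hp, ← Real.rpow_mul hu0.le, hy]; congr 1; field_simp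
  have hup : u * p = y := by
    have e : 1 + -(q / (q + 1)) = 1 / (q + 1) := by field_simp; ring
    rw [hp, ← Real.rpow_one_add' hu0.le (by rw [e]; positivity), e]
  -- This is exactly the threshold on `u`, since u / y = u^{q/(q+1)}.
  have hgap : 0 < u - y * (1 + 2 * S) := by
    have h1 : 1 + 2 * S < u ^ (q / (q + 1)) := by
      have h2 := Real.rpow_lt_rpow (by positivity) hu (show 0 < q / (q + 1) by positivity)
      rwa [← Real.rpow_mul (by positivity), show (q + 1) / q * (q / (q + 1)) = 1 by field_simp,
        Real.rpow_one] at h2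
    have h3 : u = y * u ^ (q / (q + 1)) := by
      rw [hy, ← Real.rpow_add hu0, show 1 / (q + 1) + q / (q + 1) = 1 by field_simp; ring,
        Real.rpow_one]
    nlinarith
  have hnum : (u - 2 * (S * (p ^ (-(1 / q)) / (1 - p)))) * (1 - p) = u - y * (1 + 2 * S) := by
    rw [hpy]
    field_simp
    linear_combination -hup
  obtain ⟨Φ, h1, -, h3⟩ := tail p hp0 hp1
  have h4 : 2 * (S * (p ^ (-(1 / q)) / (1 - p))) < u := by
    rw [← hnum] at hgap
    have := pos_of_mul_pos_left hgap hp1'.le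
    linarith
  have hbound := h3 u h4
  have hexp : (u - 2 * (S * (p ^ (-(1 / q)) / (1 - p)))) / (C * (1 - p)⁻¹) =
      (u - y * (1 + 2 * S)) / C := by
    rw [← hnum]; field_simp
  rw [hexp, Real.div_rpow hgap.le hCpos.le] at hbound
  have hfin : μ {ω | u < (Ψ ω).toReal} ≤ μ {ω | ENNReal.ofReal u < Φ ω} := by
    refine measure_mono_ae ?_
    filter_upwards [hΨle Φ h1] with ω hω hlt
    replace hlt : u < (Ψ ω).toReal := hlt
    -- Where Ψ = ⊤, `toReal` is 0 and cannot exceed u > 0.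
    have htop : Ψ ω ≠ ⊤ := fun h => by
      rw [h, ENNReal.toReal_top] at hlt
      exact lt_asymm hu0 hlt
    exact ((ENNReal.ofReal_lt_iff_lt_toReal hu0.le htop).2 hlt).trans_le hω
  refine ENNReal.toReal_le_of_le_ofReal (by positivity) (hfin.trans (hbound.trans_eq ?_))
  congr 3
  field_simp
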